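/- Let $E$ be an elliptic curve, let $n\ge 0$, and consider the braid elliptic arrangement of the divisors $\{P_i=P_j\}$, $i\neq j$, in $E^n$, whose complement is the configuration space of $n$ ordered distinct points of $E$. Let $(E_2^{\bullet,\bullet},d_2)$ be the second page of the associated Leray spectral sequence (the Kriz model), given explicitly as follows. $E_2^{\bullet,\bullet}$ is the bigraded-commutative $\mathbb{Q}$-algebra generated by $x_i,y_i$ ($1\le i\le n$), of bidegree $(1,0)$, and $\omega_{i,j}=\omega_{j,i}$ ($i\ne j$), of bidegree $(0,1)$, with any two generators anticommuting and every generator having square zero, subject to the relations $$(x_i-x_j)\,\omega_{i,j}=0,\qquad (y_i-y_j)\,\omega_{i,j}=0,\qquad \omega_{i,j}\omega_{j,k}+\omega_{j,k}\omega_{k,i}+\omega_{k,i}\omega_{i,j}=0\quad (i,j,k\text{ distinct}),$$ and $d_2$ is the derivation, odd with respect to the total degree and of bidegree $(2,-1)$, with $d_2x_i=d_2y_i=0$ and $d_2\omega_{i,j}=(x_i-x_j)(y_i-y_j)$. (Here $x_i,y_i$ are the pull-backs under the $i$-th projection $E^n\to E$ of a basis of $H^1(E;\mathbb{Q})$.)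 Let $E_3^{p,q}=\ker(d_2\colon E_2^{p,q}\to E_2^{p+2,q-1})/d_2(E_2^{p-2,q+1})$ and $e_3^{p,q}(n)=\dim_{\mathbb{Q}}E_3^{p,q}$. A circuit $C=(c_1,\dots,c_k)$, $k\ge 3$, of the complete graph $K_n$ is a simple cycle with $k$ edges, together with an orientation and a starting vertex; $c_1,\dots,c_k$ are its successive oriented edges, $s(c)$ and $t(c)$ are the starting and the final vertex of an edge $c$, and $\omega_c=\omega_{s(c),t(c)}$. It is called standard if its two greatest vertices are adjacent in the cycle. Put $$L_C=\sum_{1\le i<j\le k}(-1)^{i+j}(x_{t(c_i)}-x_{s(c_i)})\,\omega_{C\setminus\{c_i,c_j\}},\qquad L'_C=\sum_{1\le i<j\le k}(-1)^{i+j}(y_{t(c_i)}-y_{s(c_i)})\,\omega_{C\setminus\{c_i,c_j\}},$$ where $\omega_{C\setminus\{c_i,c_j\}}$ is the product of the $\omega_{c_l}$ with $l\neq i,j$, in increasing order of $l$. **Theorem.** Let $S$ be any set of standard circuits of $K_n$ (of arbitrary lengths) in which no two distinct circuits have the same underlying (unoriented, unpointed) cycle; for instance, choose one orientation and one starting vertex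 for every cycle of $K_n$ of length at least $3$ whose two greatest vertices are adjacent. Then $L_C,L'_C\in E_2^{1,k-2}$ for every $C\in S$ with $k$ edges, and the elements $L_C$ ($C\in S$) and $L'_C$ ($C\in S$) are, all together, linearly independent over $\mathbb{Q}$. Moreover, for every $q\ge 1$, $$e_3^{1,q}(n)\ \ge\ 2\binom{n}{q+2}\,q!\,.$$ -/

import Mathlib

namespace BraidElliptic

/-- Generators of the second page `E₂` for the braid arrangement in `E ^ n`: the classes
`x i = prᵢ^* x` and `y i = prᵢ^* y`, where `{x, y}` is a basis of `H¹(E)` and `prᵢ : E ^ n → E` is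
the `i`-th projection, and the classes `ω i j` of the divisors `{Pᵢ = Pⱼ}`. -/
inductive Gen (n : ℕ) : Type
  | x (i : Fin n)
  | y (i : Fin n)
  | om (i j : Fin n)

/-- `true` on the generators `x i`, `y i` of bidegree `(1, 0)`, and `false` on the generators
`ω i j`, of bidegree `(0, 1)`. -/
def Gen.isBase {n : ℕ} : Gen n → Bool
  | .x _ => true
  | .y _ => true
  | .om _ _ => false

open FreeAlgebra in
/-- The defining relations of `E₂`. All generators have odd total degree, hence they anticommute;
over `ℚ`, the relation `anticomm g g` says that the square of `g` vanishes. -/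
inductive Rel (n : ℕ) : FreeAlgebra ℚ (Gen n) → FreeAlgebra ℚ (Gen n) → Prop
  | anticomm (g h : Gen n) : Rel n (ι ℚ g * ι ℚ h) (-(ι ℚ h * ι ℚ g))
  | symm (i j : Fin n) : Rel n (ι ℚ (.om i j)) (ι ℚ (.om j i))
  | diag (i : Fin n) : Rel n (ι ℚ (.om i i)) 0
  | x_om (i j : Fin n) : Rel n (ι ℚ (.x i) * ι ℚ (.om i j)) (ι ℚ (.x j) * ι ℚ (.om i j))
  | y_om (i j : Fin n) : Rel n (ι ℚ (.y i) * ι ℚ (.om i j)) (ι ℚ (.y j) * ι ℚ (.om i j))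
  | arnold (i j k : Fin n) (hij : i ≠ j) (hjk : j ≠ k) (hki : k ≠ i) :
      Rel n (ι ℚ (.om i j) * ι ℚ (.om j k) + ι ℚ (.om j k) * ι ℚ (.om k i)
        + ι ℚ (.om k i) * ι ℚ (.om i j)) 0

/-- The rational algebra `E₂` of the braid elliptic arrangement in `E ^ n` (the Kriz model of the
configuration space of `n` ordered points on an elliptic curve): the graded commutative algebra
on the classes `x i`, `y i`, `ω i j` with `ω i j = ω j i`, `(x i - x j) ω i j = 0`,
`(y i - y j) ω i j = 0` and the Arnold relations. -/
def Alg (n : ℕ) : Type := RingQuot (Rel n)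

variable {n : ℕ}

noncomputable instance : Ring (Alg n) := inferInstanceAs (Ring (RingQuot (Rel n)))

noncomputable instance : Algebra ℚ (Alg n) := inferInstanceAs (Algebra ℚ (RingQuot (Rel n)))

/-- The quotient map. -/
noncomputable def mk (n : ℕ) : FreeAlgebra ℚ (Gen n) →ₐ[ℚ] Alg n :=
  RingQuot.mkAlgHom ℚ (Rel n)

theorem mk_surjective : Function.Surjective (mk n) := RingQuot.mkAlgHom_surjective ℚ (Rel n)

theorem mk_rel {a b : FreeAlgebra ℚ (Gen n)} (h : Rel n a b) : mk n a = mk n b :=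
  RingQuot.mkAlgHom_rel ℚ h

/-- The universal property of the quotient. -/
noncomputable def lift {B : Type*} [Ring B] [Algebra ℚ B] (f : FreeAlgebra ℚ (Gen n) →ₐ[ℚ] B)
    (hf : ∀ ⦃a b⦄, Rel n a b → f a = f b) : Alg n →ₐ[ℚ] B :=
  RingQuot.liftAlgHom ℚ ⟨f, hf⟩

theorem lift_mk {B : Type*} [Ring B] [Algebra ℚ B] (f : FreeAlgebra ℚ (Gen n) →ₐ[ℚ] B)
    (hf : ∀ ⦃a b⦄, Rel n a b → f a = f b) (a : FreeAlgebra ℚ (Gen n)) :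
    lift f hf (mk n a) = f a :=
  RingQuot.liftAlgHom_mkAlgHom_apply ℚ f hf a

/-- The class in `E₂` of a generator. -/
noncomputable def gen (g : Gen n) : Alg n :=
  mk n (FreeAlgebra.ι ℚ g)

noncomputable def x (i : Fin n) : Alg n := gen (.x i)

noncomputable def y (i : Fin n) : Alg n := gen (.y i)

noncomputable def om (i j : Fin n) : Alg n := gen (.om i j)

theorem gen_anticomm (g h : Gen n) : gen g * gen h = -(gen h * gen g) := by
  have := mk_rel (Rel.anticomm g h)
  simpa [gen] using this

theorem gen_mul_self (g : Gen n) : gen g * gen g = 0 := by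
  have h := gen_anticomm g g
  have h2 : (2 : ℚ) • (gen g * gen g) = 0 := by
    rw [two_smul]; nth_rewrite 2 [h]; exact add_neg_cancel _
  simpa using h2

theorem om_symm (i j : Fin n) : om i j = om j i :=
  mk_rel (Rel.symm i j)

theorem om_diag (i : Fin n) : om i i = 0 := by
  have := mk_rel (Rel.diag i)
  simpa [om, gen] using this

theorem x_om (i j : Fin n) : x i * om i j = x j * om i j := by
  have := mk_rel (Rel.x_om i j)
  simpa [x, om, gen] using this

theorem y_om (i j : Fin n) : y i * om i j = y j * om i j := by
  have := mk_rel (Rel.y_om i j)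
  simpa [y, om, gen] using this

theorem arnold (i j k : Fin n) (hij : i ≠ j) (hjk : j ≠ k) (hki : k ≠ i) :
    om i j * om j k + om j k * om k i + om k i * om i j = 0 := by
  have := mk_rel (Rel.arnold i j k hij hjk hki)
  simpa [om, gen] using this

/-- The values of the differential on the generators: `d x i = d y i = 0`, and `d (ω i j)` is the
class of the divisor `{Pᵢ = Pⱼ}`, which is the pull-back of the class `x y` of a point of `E`
under the map `P ↦ Pᵢ - Pⱼ`. -/
noncomputable def dGen : Gen n → Alg n
  | .x _ => 0
  | .y _ => 0
  | .om i j => (x i - x j) * (y i - y j)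

theorem gen_comm_dGen (g h : Gen n) : gen g * dGen h = dGen h * gen g := by
  cases h with
  | x i => simp [dGen]
  | y i => simp [dGen]
  | om i j =>
    have e1 : gen g * (x i - x j) = -((x i - x j) * gen g) := by
      simp only [mul_sub, sub_mul, x, gen_anticomm g]; abel
    have e2 : gen g * (y i - y j) = -((y i - y j) * gen g) := by
      simp only [mul_sub, sub_mul, y, gen_anticomm g]; abel
    simp only [dGen]
    rw [← mul_assoc, e1, neg_mul, mul_assoc, e2, mul_neg, neg_neg, mul_assoc]

/-- The algebra homomorphism `a ↦ !![σ a, d a; 0, a]`, where `σ` is the sign involution of the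
total grading: it is multiplicative exactly because `d (a b) = d a * b + σ a * d b`. -/
noncomputable def freeHom (n : ℕ) : FreeAlgebra ℚ (Gen n) →ₐ[ℚ] Matrix (Fin 2) (Fin 2) (Alg n) :=
  FreeAlgebra.lift ℚ fun g => !![-gen g, dGen g; 0, gen g]

theorem freeHom_rel {a b : FreeAlgebra ℚ (Gen n)} (h : Rel n a b) :
    freeHom n a = freeHom n b := by
  have oy : ∀ i j k : Fin n, om i j * y k = -(y k * om i j) := fun _ _ _ => gen_anticomm _ _
  cases h with
  | anticomm g h =>
    simp only [freeHom, map_mul, map_neg, FreeAlgebra.lift_ι_apply]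
    ext i j
    fin_cases i <;> fin_cases j <;>
      simp [Matrix.mul_apply, Fin.sum_univ_two, gen_anticomm g h, gen_comm_dGen]
  | symm i j =>
    have hd : dGen (.om i j) = dGen (.om j i) := by
      simp only [dGen]; rw [← neg_sub (x j), ← neg_sub (y j), neg_mul_neg]
    have ho : gen (.om i j) = gen (.om j i) := om_symm i j
    simp [freeHom, hd, ho]
  | diag i =>
    have ho : gen (.om i i) = 0 := om_diag i
    simp only [freeHom, map_zero, FreeAlgebra.lift_ι_apply]
    ext a b
    fin_cases a <;> fin_cases b <;> simp [dGen, ho]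
  | x_om i j =>
    have hr : gen (.x i) * gen (.om i j) = gen (.x j) * gen (.om i j) := x_om i j
    have hd : x i * dGen (.om i j) = x j * dGen (.om i j) := by
      rw [← sub_eq_zero, ← sub_mul, dGen, ← mul_assoc]
      have : (x i - x j) * (x i - x j) = 0 := by
        have hii : ∀ k : Fin n, x k * x k = 0 := fun k =>
          gen_mul_self (.x k)
        have hij : x i * x j = -(x j * x i) := gen_anticomm _ _
        simp [sub_mul, mul_sub, hii, hij]
      rw [this, zero_mul]
    simp only [freeHom, map_mul, FreeAlgebra.lift_ι_apply]
    ext a b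
    fin_cases a <;> fin_cases b <;>
      simp [Matrix.mul_apply, Fin.sum_univ_two, hr]
    simpa [x, dGen] using hd
  | y_om i j =>
    have hr : gen (.y i) * gen (.om i j) = gen (.y j) * gen (.om i j) := y_om i j
    have hd : y i * dGen (.om i j) = y j * dGen (.om i j) := by
      rw [← sub_eq_zero, ← sub_mul, dGen, ← mul_assoc]
      have hc : (y i - y j) * (x i - x j) = -((x i - x j) * (y i - y j)) := by
        have : ∀ k l : Fin n, y k * x l = -(x l * y k) := fun _ _ => gen_anticomm _ _
        simp only [sub_mul, mul_sub, this]; abel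
      have : (y i - y j) * (y i - y j) = 0 := by
        have hii : ∀ k : Fin n, y k * y k = 0 := fun k =>
          gen_mul_self (.y k)
        have hij : y i * y j = -(y j * y i) := gen_anticomm _ _
        simp [sub_mul, mul_sub, hii, hij]
      rw [hc, neg_mul, mul_assoc, this, mul_zero, neg_zero]
    simp only [freeHom, map_mul, FreeAlgebra.lift_ι_apply]
    ext a b
    fin_cases a <;> fin_cases b <;>
      simp [Matrix.mul_apply, Fin.sum_univ_two, hr]
    simpa [y, dGen] using hd
  | arnold i j k hij hjk hki =>
    have har : gen (.om i j) * gen (.om j k) + gen (.om j k) * gen (.om k i)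
        + gen (.om k i) * gen (.om i j) = 0 := arnold i j k hij hjk hki
    have hu : ∀ a b c : Fin n, dGen (.om b c) * gen (.om a b) = dGen (.om c a) * gen (.om a b) := by
      intro a b c
      have e1 : (y b - y c) * om a b = (y a - y c) * om a b := by
        rw [sub_mul, sub_mul, y_om]
      have e2 : (x b - x c) * om a b = (x a - x c) * om a b := by
        rw [sub_mul, sub_mul, x_om]
      have e3 : ∀ k l : Fin n, (y k - y l) * om a b = -(om a b * (y k - y l)) := fun k l => by
        rw [mul_sub, oy, oy, sub_mul]; abel
      change (x b - x c) * (y b - y c) * om a b = (x c - x a) * (y c - y a) * om a b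
      rw [mul_assoc, e1, e3, mul_neg, ← mul_assoc, e2, mul_assoc, ← mul_neg, ← e3, ← mul_assoc,
        ← neg_sub (x a), ← neg_sub (y a), neg_mul_neg]
    simp only [freeHom, map_mul, map_add, map_zero, FreeAlgebra.lift_ι_apply]
    ext a b
    fin_cases a <;> fin_cases b <;>
      simp [har]
    rw [gen_comm_dGen, gen_comm_dGen, gen_comm_dGen, hu i j k, hu j k i, hu k i j]
    abel

noncomputable def matHom (n : ℕ) : Alg n →ₐ[ℚ] Matrix (Fin 2) (Fin 2) (Alg n) :=
  lift (freeHom n) fun _ _ h => freeHom_rel h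

/-- The differential `d₂`: the odd derivation with the prescribed values on the generators. -/
noncomputable def d (n : ℕ) : Alg n →ₗ[ℚ] Alg n :=
  (Matrix.entryLinearMap ℚ (Alg n) (0 : Fin 2) (1 : Fin 2)).comp (matHom n).toLinearMap

theorem matHom_gen (g : Gen n) : matHom n (gen g) = !![-gen g, dGen g; 0, gen g] := by
  simp [matHom, gen, freeHom, lift_mk]

theorem d_one : d n 1 = 0 := by
  simp [d]

theorem d_gen (g : Gen n) : d n (gen g) = dGen g := by
  simp [d, matHom_gen]

@[elab_as_elim]
theorem gen_induction {P : Alg n → Prop} (h1 : P 1) (hmul : ∀ g a, P a → P (gen g * a))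
    (hadd : ∀ a b, P a → P b → P (a + b)) (hsmul : ∀ (c : ℚ) a, P a → P (c • a)) (a : Alg n) :
    P a := by
  obtain ⟨a, rfl⟩ := mk_surjective a
  suffices H : ∀ b : Alg n, P b → P (mk n a * b) by
    simpa using H 1 h1
  induction a using FreeAlgebra.induction with
  | grade0 r => intro b hb; simpa [← Algebra.smul_def] using hsmul r b hb
  | grade1 g => intro b hb; exact hmul g b hb
  | mul a b ha hb => intro c hc; rw [map_mul, mul_assoc]; exact ha _ (hb _ hc)
  | add a b ha hb => intro c hc; rw [map_add, add_mul]; exact hadd _ _ (ha _ hc) (hb _ hc)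

theorem matHom_one_one (a : Alg n) : matHom n a 1 1 = a ∧ matHom n a 1 0 = 0 := by
  induction a using gen_induction with
  | h1 => simp
  | hmul g a ih => simp [map_mul, matHom_gen, Matrix.mul_apply, Fin.sum_univ_two, ih.1, ih.2]
  | hadd a b ha hb => simp [ha.1, ha.2, hb.1, hb.2]
  | hsmul c a ih => simp [ih.1, ih.2]

/-- The graded Leibniz rule. -/
theorem d_gen_mul (g : Gen n) (a : Alg n) : d n (gen g * a) = dGen g * a - gen g * d n a := by
  change matHom n (gen g * a) 0 1 = dGen g * a - gen g * matHom n a 0 1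
  rw [map_mul, matHom_gen, Matrix.mul_apply, Fin.sum_univ_two, (matHom_one_one a).1]
  simp [sub_eq_neg_add]

theorem d_d (a : Alg n) : d n (d n a) = 0 := by
  have key : ∀ (g : Gen n) (b : Alg n), d n (dGen g * b) = dGen g * d n b := by
    intro g b
    cases g with
    | x i => simp [dGen]
    | y i => simp [dGen]
    | om i j =>
      have hx : ∀ (i : Fin n) c, d n (x i * c) = -(x i * d n c) := fun i c => by
        simpa [dGen, x] using d_gen_mul (.x i) c
      have hy : ∀ (i : Fin n) c, d n (y i * c) = -(y i * d n c) := fun i c => by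
        simpa [dGen, y] using d_gen_mul (.y i) c
      simp only [dGen, mul_assoc, sub_mul, mul_sub, map_sub, hx, hy, mul_neg]
      abel
  induction a using gen_induction with
  | h1 => simp [d_one]
  | hmul g a ih => rw [d_gen_mul, map_sub, key, d_gen_mul, ih]; simp
  | hadd a b ha hb => simp [ha, hb]
  | hsmul c a ih => simp [ih]

/-- The bihomogeneous component `E₂^{p,q}`, spanned by the products of `p` generators `x i`, `y i`
and `q` generators `ω i j`. -/
noncomputable def E₂ (n p q : ℕ) : Submodule ℚ (Alg n) :=
  Submodule.span ℚ {a | ∃ l : List (Gen n),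
    l.countP (fun g => g.isBase) = p ∧ l.countP (fun g => !g.isBase) = q ∧ (l.map gen).prod = a}

/-- The kernel of `d₂ : E₂^{p,q} → E₂^{p+2,q-1}`. -/
noncomputable def cycles (n p q : ℕ) : Submodule ℚ (Alg n) :=
  E₂ n p q ⊓ LinearMap.ker (d n)

/-- The image of `d₂ : E₂^{p-2,q+1} → E₂^{p,q}`; it is zero for `p < 2`. -/
noncomputable def boundaries (n : ℕ) : ℕ → ℕ → Submodule ℚ (Alg n)
  | p + 2, q => (E₂ n p (q + 1)).map (d n)
  | _, _ => ⊥

/-- The component `E₃^{p,q}` of the third page. -/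
abbrev E₃ (n p q : ℕ) : Type :=
  ↥(cycles n p q) ⧸ (boundaries n p q).submoduleOf (cycles n p q)

/-- The dimension of `E₃^{p,q}`. -/
noncomputable def e₃ (n p q : ℕ) : ℕ := Module.finrank ℚ (E₃ n p q)

/-- A circuit of the complete graph on `Fin n`: a simple cycle with at least three edges, with an
orientation and a starting vertex. It is given by its successive vertices. -/
structure Circuit (n : ℕ) where
  length : ℕ
  two_lt_length : 2 < length
  vertex : Fin length → Fin n
  vertex_injective : Function.Injective vertex

namespace Circuit

/-- The starting vertex of the `i`-th edge. -/
def s (C : Circuit n) (i : Fin C.length) : Fin n := C.vertex i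

/-- The final vertex of the `i`-th edge, that is, the cyclically next vertex. -/
def t (C : Circuit n) (i : Fin C.length) : Fin n := C.vertex (finRotate C.length i)

/-- The underlying cycle of a circuit (without orientation and starting vertex), as the set of its
edges. -/
def cycle (C : Circuit n) : Set (Sym2 (Fin n)) := Set.range fun i => s(C.s i, C.t i)

/-- A circuit is standard if its two greatest vertices are adjacent. -/
def IsStandard (C : Circuit n) : Prop :=
  ∃ i : Fin C.length, ∀ k : Fin C.length, C.vertex k ≠ C.s i → C.vertex k ≠ C.t i →
    C.vertex k < C.s i ∧ C.vertex k < C.t i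

/-- The ordered product of the classes `ω` of all the edges except the `i`-th and the `j`-th. -/
noncomputable def omErase (C : Circuit n) (i j : Fin C.length) : Alg n :=
  (((List.finRange C.length).filter fun l => l ≠ i ∧ l ≠ j).map fun l => om (C.s l) (C.t l)).prod

/-- The element `L_C`. Edges are numbered from `0`, which does not change the parity of `i + j`. -/
noncomputable def L (C : Circuit n) : Alg n :=
  ∑ i : Fin C.length, ∑ j ∈ Finset.Ioi i,
    (-1 : ℚ) ^ ((i : ℕ) + (j : ℕ)) • ((x (C.t i) - x (C.s i)) * C.omErase i j)

/-- The element `L'_C`. -/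
noncomputable def L' (C : Circuit n) : Alg n :=
  ∑ i : Fin C.length, ∑ j ∈ Finset.Ioi i,
    (-1 : ℚ) ^ ((i : ℕ) + (j : ℕ)) • ((y (C.t i) - y (C.s i)) * C.omErase i j)

end Circuit

end BraidElliptic

/-!
Linear independence is proved by exhibiting, for each circuit, a linear form on `E₂` which vanishes
on all the other elements of the family. The rotation `x ↦ y`, `y ↦ -x` of `H¹(E)` exchanges the
`L_C` and the `L'_C` up to sign and commutes with `d₂`, so that it suffices to treat the `L_C`.

Up to orientation and starting vertex, a standard circuit can be written `(m, v₁, …, v_{k-1})`,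
where `v₁` is its greatest vertex and `m` the second greatest one; this is its normal form `N`. Send
`x_m` to `e₁`, all the other `x_i`, `y_i` to `0`, and `ω_{v_a, v_b}` to `e_{max(a, b)}`, all the other
`ω_{i,j}` to `0`. This defines a homomorphism from `E₂` to an exterior algebra
(`Circuit.toExterior`), and `Circuit.form` is the coefficient of `e₁ e₂ ⋯ e_{k-1}`. Since
the classes of the edges at `m` are killed, the only term of `L_C` which may survive is the one in
which the two edges at `m` are erased. It survives for `C = N` (`Circuit.form_L_ne_zero`).
Conversely, if it survives for a standard circuit `C`, then `C` has the same vertices as `N`, because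
its length is `k` and `ω_{i,j}` is killed when `i` or `j` is not in `N`. Hence `C` has the same two
greatest vertices, and the path from `v₁` obtained by deleting `m` from `C` has edges with distinct
labels. Then the labels of its vertices have no interior local maximum, so that they increase
(`Circuit.eq_self_of_max_injective`), and `C` has normal form `N`
(`Circuit.IsNormal.eq_of_form_ne_zero`).

The elements `L_C` are cycles by induction on the length of a path. For a path from `a` to `b` put
`U = x_b - x_a`, `V = y_b - y_a`, let `W` be the product of the classes of its edges, and let `∂W`
and `L` be the alternating sums of these products with one and two erased factors, the latter
weighted as in `L_C`. Then `U W = V W = 0`, `d W = U V ∂W`, `U d(∂W) = -U V L`, and `d L` lies in the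
ideal generated by `U` and `V` (`d_erasedSum₂_path`). For a closed path `U = V = 0`.

No nonzero boundary has bidegree `(1, q)`. Hence `e₃^{1,q}` is at least the number of the elements
`L_C` and `L'_C` for the circuits with `q + 2` vertices in normal form, of which there are
`q!` for each set of vertices.
-/

namespace BraidElliptic

variable {n : ℕ}

/-! ### Alternating sums of products with one or two erased factors -/

section ErasedSums

theorem prod_map_finRange_succ {M : Type*} [Monoid M] {k : ℕ} (ω : Fin (k + 1) → M) :
    ((List.finRange (k + 1)).map ω).prod
      = ω 0 * ((List.finRange k).map fun l => ω l.succ).prod := by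
  rw [List.finRange_succ, List.map_cons, List.prod_cons, List.map_map]; rfl

variable {A : Type*} [Ring A] [Algebra ℚ A]

/-- The alternating sum of the products of the `ω l` with one factor erased. -/
noncomputable def erasedSum {k : ℕ} (ω : Fin k → A) : A :=
  ∑ i : Fin k, (-1 : ℚ) ^ (i : ℕ) • (((List.finRange k).filter fun l => l ≠ i).map ω).prod

/-- The alternating sum, over `i < j`, of `u i` times the product of the `ω l` with the `i`-th and
the `j`-th factors erased. -/
noncomputable def erasedSum₂ {k : ℕ} (u ω : Fin k → A) : A :=
  ∑ i : Fin k, ∑ j ∈ Finset.Ioi i, (-1 : ℚ) ^ ((i : ℕ) + (j : ℕ)) •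
    (u i * (((List.finRange k).filter fun l => l ≠ i ∧ l ≠ j).map ω).prod)

theorem erasedSum_succ {k : ℕ} (ω : Fin (k + 1) → A) :
    erasedSum ω = ((List.finRange k).map fun l => ω l.succ).prod
      - ω 0 * erasedSum fun l => ω l.succ := by
  have h0 : (((List.finRange (k + 1)).filter fun l => l ≠ 0).map ω).prod
      = ((List.finRange k).map fun l => ω l.succ).prod := by
    simp [List.finRange_succ, List.filter_map, Function.comp_def]
  have hs (i : Fin k) : (((List.finRange (k + 1)).filter fun l => l ≠ i.succ).map ω).prod
      = ω 0 * (((List.finRange k).filter fun l => l ≠ i).map fun l => ω l.succ).prod := by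
    simp [List.finRange_succ, List.filter_map, Function.comp_def, (Fin.succ_ne_zero _).symm]
  rw [erasedSum, Fin.sum_univ_succ, h0, sub_eq_add_neg]
  congr 1
  · simp
  · simp only [hs, erasedSum, Finset.mul_sum, ← Finset.sum_neg_distrib]
    exact Finset.sum_congr rfl fun i _ => by simp [pow_succ]

theorem erasedSum₂_succ {k : ℕ} (u ω : Fin (k + 1) → A) (h : ∀ i, u i * ω 0 = -(ω 0 * u i)) :
    erasedSum₂ u ω = -(u 0 * erasedSum fun l => ω l.succ)
      - ω 0 * erasedSum₂ (fun l => u l.succ) fun l => ω l.succ := by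
  have h0 (j : Fin k) : (((List.finRange (k + 1)).filter fun l => l ≠ 0 ∧ l ≠ j.succ).map ω).prod
      = (((List.finRange k).filter fun l => l ≠ j).map fun l => ω l.succ).prod := by
    simp [List.finRange_succ, List.filter_map, Function.comp_def]
  have hs (i j : Fin k) :
      (((List.finRange (k + 1)).filter fun l => l ≠ i.succ ∧ l ≠ j.succ).map ω).prod
      = ω 0 * (((List.finRange k).filter fun l => l ≠ i ∧ l ≠ j).map fun l => ω l.succ).prod := by
    simp [List.finRange_succ, List.filter_map, Function.comp_def, (Fin.succ_ne_zero _).symm]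
  rw [erasedSum₂, Fin.sum_univ_succ, sub_eq_add_neg]
  congr 1
  · rw [Fin.sum_Ioi_zero]
    simp only [h0, erasedSum, Finset.mul_sum, ← Finset.sum_neg_distrib]
    exact Finset.sum_congr rfl fun i _ => by simp [pow_succ]
  · simp only [Fin.sum_Ioi_succ, hs, erasedSum₂, Finset.mul_sum, ← Finset.sum_neg_distrib]
    refine Finset.sum_congr rfl fun i _ => Finset.sum_congr rfl fun j _ => ?_
    rw [← mul_assoc, h, neg_mul, smul_neg, mul_smul_comm, mul_assoc]
    congr 2
    simp only [Fin.val_succ]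
    ring

end ErasedSums

/-! ### The differential of the elements attached to a path -/

section Differential

theorem sub_x_mul_self (a b : Fin n) : (x b - x a) * (x b - x a) = 0 := by
  have hii : ∀ k : Fin n, x k * x k = 0 := fun k => gen_mul_self (.x k)
  have hij : x b * x a = -(x a * x b) := gen_anticomm _ _
  simp [sub_mul, mul_sub, hii, hij]

theorem sub_x_anticomm_sub_x (a b a' b' : Fin n) :
    (x b - x a) * (x b' - x a') = -((x b' - x a') * (x b - x a)) := by
  have h : ∀ k l : Fin n, x k * x l = -(x l * x k) := fun _ _ => gen_anticomm _ _
  simp only [sub_mul, mul_sub, h b, h a]; abel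

theorem sub_y_anticomm_sub_x (a b a' b' : Fin n) :
    (y b - y a) * (x b' - x a') = -((x b' - x a') * (y b - y a)) := by
  have h : ∀ k l : Fin n, y k * x l = -(x l * y k) := fun _ _ => gen_anticomm _ _
  simp only [sub_mul, mul_sub, h]; abel

theorem sub_x_anticomm_om (a b i j : Fin n) :
    (x b - x a) * om i j = -(om i j * (x b - x a)) := by
  have h : ∀ k : Fin n, x k * om i j = -(om i j * x k) := fun _ => gen_anticomm _ _
  simp only [sub_mul, mul_sub, h]; abel

theorem sub_y_anticomm_om (a b i j : Fin n) :
    (y b - y a) * om i j = -(om i j * (y b - y a)) := by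
  have h : ∀ k : Fin n, y k * om i j = -(om i j * y k) := fun _ => gen_anticomm _ _
  simp only [sub_mul, mul_sub, h]; abel

theorem sub_x_mul_om (a b : Fin n) : (x b - x a) * om a b = 0 := by
  rw [sub_mul, x_om a b, sub_self]

theorem sub_y_mul_om (a b : Fin n) : (y b - y a) * om a b = 0 := by
  rw [sub_mul, y_om a b, sub_self]

theorem d_sub_x_mul (i j : Fin n) (a : Alg n) : d n ((x i - x j) * a) = -((x i - x j) * d n a) := by
  have hx : ∀ (i : Fin n) c, d n (x i * c) = -(x i * d n c) := fun i c => by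
    simpa [dGen, x] using d_gen_mul (.x i) c
  rw [sub_mul, map_sub, hx, hx, sub_mul]; abel

theorem d_om_mul (i j : Fin n) (a : Alg n) :
    d n (om i j * a) = (x j - x i) * (y j - y i) * a - om i j * d n a := by
  rw [om, d_gen_mul, dGen, ← neg_sub (x j), ← neg_sub (y j), neg_mul_neg]

/-- The class `ω` of the `l`-th edge of a path. -/
noncomputable def pathOm (p : ℕ → Fin n) (k : ℕ) (l : Fin k) : Alg n := om (p l) (p (l + 1))

/-- The difference of the classes `x` of the end points of the `l`-th edge of a path. -/
noncomputable def pathX (p : ℕ → Fin n) (k : ℕ) (l : Fin k) : Alg n := x (p (l + 1)) - x (p l)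

theorem pathOm_succ (p : ℕ → Fin n) (k : ℕ) :
    (fun l : Fin k => pathOm p (k + 1) l.succ) = pathOm (fun j => p (j + 1)) k := rfl

theorem pathX_succ (p : ℕ → Fin n) (k : ℕ) :
    (fun l : Fin k => pathX p (k + 1) l.succ) = pathX (fun j => p (j + 1)) k := rfl

theorem sub_x_split (k : ℕ) (p : ℕ → Fin n) :
    x (p (k + 1)) - x (p 0) = (x (p 1) - x (p 0)) + (x (p (k + 1)) - x (p 1)) := by
  abel

theorem sub_y_split (k : ℕ) (p : ℕ → Fin n) :
    y (p (k + 1)) - y (p 0) = (y (p 1) - y (p 0)) + (y (p (k + 1)) - y (p 1)) := by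
  abel

/-- The values `x` and `y` at the two ends of a path agree after multiplication by the classes of
all its edges. -/
theorem sub_mul_prod_pathOm (k : ℕ) (p : ℕ → Fin n) :
    (x (p k) - x (p 0)) * ((List.finRange k).map (pathOm p k)).prod = 0 ∧
      (y (p k) - y (p 0)) * ((List.finRange k).map (pathOm p k)).prod = 0 := by
  induction k generalizing p with
  | zero => simp
  | succ k ih =>
    obtain ⟨ihx, ihy⟩ := ih fun j => p (j + 1)
    have hx := sub_x_anticomm_om (p 1) (p (k + 1)) (p 0) (p 1)
    have hy := sub_y_anticomm_om (p 1) (p (k + 1)) (p 0) (p 1)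
    rw [prod_map_finRange_succ, pathOm_succ]
    change _ * (om (p 0) (p 1) * _) = 0 ∧ _ * (om (p 0) (p 1) * _) = 0
    simp only [zero_add] at ihx ihy
    constructor
    · rw [sub_x_split k p, ← mul_assoc, add_mul, sub_x_mul_om, hx, zero_add, neg_mul, mul_assoc, ihx,
        mul_zero, neg_zero]
    · rw [sub_y_split k p, ← mul_assoc, add_mul, sub_y_mul_om, hy, zero_add, neg_mul, mul_assoc, ihy,
        mul_zero, neg_zero]

/-- The formula `d W = U V ∂W` for the product `W` of the classes of the edges. The other edges of
the path identify the classes on either side of an erased edge with those of the two end points. -/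
theorem d_prod_pathOm (k : ℕ) (p : ℕ → Fin n) :
    d n ((List.finRange k).map (pathOm p k)).prod
      = (x (p k) - x (p 0)) * (y (p k) - y (p 0)) * erasedSum (pathOm p k) := by
  induction k generalizing p with
  | zero => simp [d_one]
  | succ k ih =>
    obtain ⟨hUW, hVW⟩ := sub_mul_prod_pathOm k fun j => p (j + 1)
    have ih := ih fun j => p (j + 1)
    rw [prod_map_finRange_succ, erasedSum_succ, pathOm_succ]
    change d n (om (p 0) (p 1) * _) = _ * (_ - om (p 0) (p 1) * _)
    rw [d_om_mul, ih, sub_x_split k p, sub_y_split k p]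
    have huo := sub_x_mul_om (p 0) (p 1)
    have hvo := sub_y_mul_om (p 0) (p 1)
    have hUo := sub_x_anticomm_om (p 1) (p (k + 1)) (p 0) (p 1)
    have hVo := sub_y_anticomm_om (p 1) (p (k + 1)) (p 0) (p 1)
    have hvU := sub_y_anticomm_sub_x (p 0) (p 1) (p 1) (p (k + 1))
    simp only [zero_add] at hUW hVW ⊢
    generalize ((List.finRange k).map (pathOm (fun j => p (j + 1)) k)).prod = W at *
    generalize erasedSum (pathOm (fun j => p (j + 1)) k) = D at *
    generalize x (p 1) - x (p 0) = u at *
    generalize y (p 1) - y (p 0) = v at *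
    generalize x (p (k + 1)) - x (p 1) = U at *
    generalize y (p (k + 1)) - y (p 1) = V at *
    generalize om (p 0) (p 1) = o at *
    linear_combination (norm := noncomm_ring) -(u + U) * hVW - hvU * W + v * hUW + u * hvo * D
      + u * hVo * D - huo * V * D + U * hvo * D + U * hVo * D - hUo * V * D

/-- The identity `U d(∂W) = -U V L`, where `U` and `V` are the differences of the classes `x` and `y`
of the end points of the path. -/
theorem sub_x_mul_d_erasedSum (k : ℕ) (p : ℕ → Fin n) :
    (x (p k) - x (p 0)) * d n (erasedSum (pathOm p k))
      = -((x (p k) - x (p 0)) * (y (p k) - y (p 0)) * erasedSum₂ (pathX p k) (pathOm p k)) := by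
  induction k generalizing p with
  | zero => simp [erasedSum, erasedSum₂]
  | succ k ih =>
    have ih := ih fun j => p (j + 1)
    have hdW := d_prod_pathOm k fun j => p (j + 1)
    rw [erasedSum_succ, erasedSum₂_succ (pathX p _) (pathOm p _) fun i => sub_x_anticomm_om _ _ _ _,
      pathOm_succ, pathX_succ]
    change _ * d n (_ - om (p 0) (p 1) * _) = -(_ * (-((x (p 1) - x (p 0)) * _) - om (p 0) (p 1) * _))
    rw [map_sub, d_om_mul, hdW, sub_x_split k p, sub_y_split k p]
    have huo := sub_x_mul_om (p 0) (p 1)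
    have hvo := sub_y_mul_om (p 0) (p 1)
    have hUo := sub_x_anticomm_om (p 1) (p (k + 1)) (p 0) (p 1)
    have hVo := sub_y_anticomm_om (p 1) (p (k + 1)) (p 0) (p 1)
    have huu := sub_x_mul_self (p 0) (p 1)
    have hUU := sub_x_mul_self (p 1) (p (k + 1))
    have hUu := sub_x_anticomm_sub_x (p 1) (p (k + 1)) (p 0) (p 1)
    have hvu := sub_y_anticomm_sub_x (p 0) (p 1) (p 0) (p 1)
    have hVu := sub_y_anticomm_sub_x (p 1) (p (k + 1)) (p 0) (p 1)
    simp only [zero_add] at ih ⊢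
    generalize d n (erasedSum (pathOm (fun j => p (j + 1)) k)) = dD at *
    generalize erasedSum (pathOm (fun j => p (j + 1)) k) = D at *
    generalize erasedSum₂ (pathX (fun j => p (j + 1)) k) (pathOm (fun j => p (j + 1)) k) = L at *
    generalize x (p 1) - x (p 0) = u at *
    generalize y (p 1) - y (p 0) = v at *
    generalize x (p (k + 1)) - x (p 1) = U at *
    generalize y (p (k + 1)) - y (p 1) = V at *
    generalize om (p 0) (p 1) = o at *
    linear_combination (norm := noncomm_ring) -huu * v * D + huo * dD + hUU * V * D + hUo * dD
      - o * ih - u * hvo * L - u * hVo * L + huo * V * L - U * hvo * L - U * hVo * L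
      + hUo * V * L - u * hvu * D + huu * v * D - u * hVu * D + huu * V * D - U * hvu * D
      - U * hVu * D + hUu * V * D

/-- For a path from `a` to `b`, the differential of the element defined like `L_C` lies in the right
ideal generated by `x b - x a` and `y b - y a`. -/
theorem d_erasedSum₂_path (k : ℕ) (p : ℕ → Fin n) :
    ∃ P Q, d n (erasedSum₂ (pathX p k) (pathOm p k))
      = (x (p k) - x (p 0)) * P + (y (p k) - y (p 0)) * Q := by
  induction k generalizing p with
  | zero => exact ⟨0, 0, by simp [erasedSum₂]⟩
  | succ k ih =>
    obtain ⟨P, Q, ih⟩ := ih fun j => p (j + 1)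
    have hB := sub_x_mul_d_erasedSum k fun j => p (j + 1)
    rw [erasedSum₂_succ (pathX p _) (pathOm p _) fun i => sub_x_anticomm_om _ _ _ _, pathOm_succ,
      pathX_succ]
    change ∃ P Q, d n (-((x (p 1) - x (p 0)) * _) - om (p 0) (p 1) * _) = _
    rw [map_sub, map_neg, d_sub_x_mul, d_om_mul, ih, sub_x_split k p, sub_y_split k p]
    have huo := sub_x_mul_om (p 0) (p 1)
    have hvo := sub_y_mul_om (p 0) (p 1)
    have hUo := sub_x_anticomm_om (p 1) (p (k + 1)) (p 0) (p 1)
    have hVo := sub_y_anticomm_om (p 1) (p (k + 1)) (p 0) (p 1)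
    have hvU := sub_y_anticomm_sub_x (p 0) (p 1) (p 1) (p (k + 1))
    have hVU := sub_y_anticomm_sub_x (p 1) (p (k + 1)) (p 1) (p (k + 1))
    simp only [zero_add] at hB ⊢
    generalize d n (erasedSum (pathOm (fun j => p (j + 1)) k)) = dD at *
    generalize erasedSum₂ (pathX (fun j => p (j + 1)) k) (pathOm (fun j => p (j + 1)) k) = L at *
    generalize x (p 1) - x (p 0) = u at *
    generalize y (p 1) - y (p 0) = v at *
    generalize x (p (k + 1)) - x (p 1) = U at *
    generalize y (p (k + 1)) - y (p 1) = V at *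
    generalize om (p 0) (p 1) = o at *
    refine ⟨dD - v * L - o * P, -(U * L) - o * Q, ?_⟩
    linear_combination (norm := noncomm_ring) -hB + hVU * L + hvU * L + huo * P + hUo * P
      + hvo * Q + hVo * Q

end Differential

/-! ### The rotation exchanging the two families of base classes -/

/-- The images of the generators under the rotation `x ↦ y`, `y ↦ -x`. -/
noncomputable def rotGen : Gen n → Alg n
  | .x i => y i
  | .y i => -x i
  | .om i j => om i j

theorem rotGen_anticomm (g h : Gen n) : rotGen g * rotGen h = -(rotGen h * rotGen g) := by
  cases g <;> cases h <;> simp only [rotGen, x, y, om, neg_mul, mul_neg] <;>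
    first | exact gen_anticomm _ _ | rw [gen_anticomm]

/-- The automorphism of `E₂` induced by the rotation `x ↦ y`, `y ↦ -x` of `H¹(E)`. The sign makes
it commute with the differential. -/
noncomputable def rot (n : ℕ) : Alg n →ₐ[ℚ] Alg n :=
  lift (FreeAlgebra.lift ℚ rotGen) fun a b h => by
    cases h with
    | anticomm g h => simpa using rotGen_anticomm g h
    | symm i j => simpa [rotGen] using om_symm i j
    | diag i => simpa [rotGen] using om_diag i
    | x_om i j => simpa [rotGen] using y_om i j
    | y_om i j => simpa [rotGen] using x_om i j
    | arnold i j k hij hjk hki => simpa [rotGen] using arnold i j k hij hjk hki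

theorem rot_gen (g : Gen n) : rot n (gen g) = rotGen g := by
  simp [rot, gen, lift_mk]

theorem rot_x (i : Fin n) : rot n (x i) = y i := rot_gen _

theorem rot_y (i : Fin n) : rot n (y i) = -x i := rot_gen _

theorem rot_om (i j : Fin n) : rot n (om i j) = om i j := rot_gen _

theorem rot_dGen (g : Gen n) : rot n (dGen g) = dGen g := by
  cases g with
  | x i => simp [dGen]
  | y i => simp [dGen]
  | om i j =>
    simp only [dGen, map_mul, map_sub, rot_x, rot_y]
    rw [neg_sub_neg, ← neg_sub (x i), mul_neg, sub_y_anticomm_sub_x j i j i, neg_neg]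

theorem d_rot (a : Alg n) : d n (rot n a) = rot n (d n a) := by
  have hx : ∀ (i : Fin n) c, d n (x i * c) = -(x i * d n c) := fun i c => by
    simpa [dGen, x] using d_gen_mul (.x i) c
  have hy : ∀ (i : Fin n) c, d n (y i * c) = -(y i * d n c) := fun i c => by
    simpa [dGen, y] using d_gen_mul (.y i) c
  induction a using gen_induction with
  | h1 => simp [d_one]
  | hmul g a ih =>
    rw [d_gen_mul, map_sub, map_mul (rot n), map_mul (rot n), map_mul (rot n), rot_dGen, rot_gen,
      ← ih]
    cases g with
    | x i => simp [rotGen, hy, dGen]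
    | y i => simp [rotGen, hx, dGen]
    | om i j => rw [rotGen, om, d_gen_mul]
  | hadd a b ha hb => simp [ha, hb]
  | hsmul c a ih => simp [ih]

/-! ### The elements `L_C` and `L'_C` are cycles of bidegree `(1, k - 2)` -/

namespace Circuit

theorem t_of_lt (C : Circuit n) (l : Fin C.length) (h : (l : ℕ) + 1 < C.length) :
    C.t l = C.vertex ⟨l + 1, h⟩ := by
  obtain ⟨k, hk, v, hv⟩ := C
  obtain ⟨k, rfl⟩ : ∃ m, k = m + 1 := ⟨k - 1, by omega⟩
  have := finRotate_of_lt (n := k) (k := l) (by simpa using h)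
  simp only [t]
  congr 1

theorem t_of_eq (C : Circuit n) (l : Fin C.length) (h : (l : ℕ) + 1 = C.length) :
    C.t l = C.vertex ⟨0, by omega⟩ := by
  obtain ⟨k, hk, v, hv⟩ := C
  obtain ⟨k, rfl⟩ : ∃ m, k = m + 1 := ⟨k - 1, by omega⟩
  obtain ⟨l, hl⟩ := l
  obtain rfl : l = k := by simpa using h
  simp only [t]
  congr 1
  exact finRotate_last'

theorem rot_L (C : Circuit n) : rot n C.L = C.L' := by
  simp only [L, L', omErase, map_sum, map_smul, map_mul, map_sub, rot_x, map_list_prod,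
    List.map_map, Function.comp_def, rot_om]

theorem rot_L' (C : Circuit n) : rot n C.L' = -C.L := by
  simp only [L, L', omErase, map_sum, map_smul, map_mul, map_sub, rot_y, map_list_prod,
    List.map_map, Function.comp_def, rot_om, ← Finset.sum_neg_distrib, ← smul_neg, ← neg_mul,
    neg_sub_neg, neg_sub]

theorem d_L (C : Circuit n) : d n C.L = 0 := by
  have hk := C.two_lt_length
  -- the closed path running once around the circuit
  let p : ℕ → Fin n := fun j => C.vertex ⟨j % C.length, Nat.mod_lt _ (by omega)⟩
  have hs (l : Fin C.length) : C.s l = p l := by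
    simp [p, s, Nat.mod_eq_of_lt l.2]
  have ht (l : Fin C.length) : C.t l = p (l + 1) := by
    rcases Nat.lt_or_ge ((l : ℕ) + 1) C.length with h | h
    · rw [C.t_of_lt l h]; simp [p, Nat.mod_eq_of_lt h]
    · have h' : (l : ℕ) + 1 = C.length := by omega
      rw [C.t_of_eq l h']; simp [p, h']
  have hL : C.L = erasedSum₂ (pathX p C.length) (pathOm p C.length) := by
    simp only [L, erasedSum₂, omErase, hs, ht]; rfl
  obtain ⟨P, Q, h⟩ := d_erasedSum₂_path C.length p
  have hp : p C.length = p 0 := by simp [p]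
  rw [hL, h, hp]
  simp

theorem d_L' (C : Circuit n) : d n C.L' = 0 := by
  rw [← rot_L, d_rot, d_L, map_zero]

theorem length_filter_finRange {k : ℕ} (i j : Fin k) (h : i ≠ j) :
    ((List.finRange k).filter fun l => l ≠ i ∧ l ≠ j).length = k - 2 := by
  rw [← List.toFinset_card_of_nodup ((List.nodup_finRange k).filter _)]
  have : ((List.finRange k).filter fun l => l ≠ i ∧ l ≠ j).toFinset = Finset.univ \ {i, j} := by
    ext l; simp
  rw [this, Finset.card_sdiff_of_subset (Finset.subset_univ _), Finset.card_pair h,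
    Finset.card_univ, Fintype.card_fin]

theorem gen_mul_omErase_mem (C : Circuit n) (g : Gen n) (hg : g.isBase = true)
    (i j : Fin C.length) (h : i ≠ j) : gen g * C.omErase i j ∈ E₂ n 1 (C.length - 2) := by
  refine Submodule.subset_span ⟨g :: (((List.finRange C.length).filter
    fun l => l ≠ i ∧ l ≠ j).map fun l => Gen.om (C.s l) (C.t l)), ?_, ?_, ?_⟩
  · rw [List.countP_cons, List.countP_map, List.countP_eq_zero.2 (by simp [Gen.isBase]), hg]
    rfl
  · rw [List.countP_cons, List.countP_map, List.countP_eq_length.2 (by simp [Gen.isBase]),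
      length_filter_finRange i j h, hg]
    rfl
  · rw [List.map_cons, List.prod_cons, List.map_map]; rfl

theorem L_mem (C : Circuit n) : C.L ∈ E₂ n 1 (C.length - 2) :=
  Submodule.sum_mem _ fun i _ => Submodule.sum_mem _ fun j hj => Submodule.smul_mem _ _ <| by
    rw [sub_mul]
    have h := (Finset.mem_Ioi.1 hj).ne
    exact Submodule.sub_mem _ (C.gen_mul_omErase_mem _ rfl i j h) (C.gen_mul_omErase_mem _ rfl i j h)

theorem L'_mem (C : Circuit n) : C.L' ∈ E₂ n 1 (C.length - 2) :=
  Submodule.sum_mem _ fun i _ => Submodule.sum_mem _ fun j hj => Submodule.smul_mem _ _ <| by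
    rw [sub_mul]
    have h := (Finset.mem_Ioi.1 hj).ne
    exact Submodule.sub_mem _ (C.gen_mul_omErase_mem _ rfl i j h) (C.gen_mul_omErase_mem _ rfl i j h)

end Circuit

/-! ### Normal forms of standard circuits -/

theorem finRotate_val {k : ℕ} (l : Fin k) :
    (finRotate k l : ℕ) = if (l : ℕ) + 1 = k then 0 else (l : ℕ) + 1 := by
  obtain ⟨l, hl⟩ := l
  obtain ⟨k, rfl⟩ : ∃ m, k = m + 1 := ⟨k - 1, by omega⟩
  split_ifs with h
  · obtain rfl : l = k := by simpa using h
    rw [finRotate_last']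
  · rw [finRotate_of_lt (by simp at h; omega)]

namespace Circuit

/-- The first vertex of a circuit. -/
def base (N : Circuit n) : Fin n := N.vertex ⟨0, by have := N.two_lt_length; omega⟩

/-- The second vertex of a circuit. -/
def next (N : Circuit n) : Fin n := N.vertex ⟨1, by have := N.two_lt_length; omega⟩

/-- A circuit is in normal form if its second vertex is the greatest one and its first vertex is the
second greatest one. -/
def IsNormal (N : Circuit n) : Prop :=
  N.base < N.next ∧ ∀ j : Fin N.length, 2 ≤ (j : ℕ) → N.vertex j < N.base

/-- Two circuits have the same edges up to orientation, as witnessed by a bijection between the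
indices of their edges. -/
def EdgeEquiv (C N : Circuit n) : Prop :=
  ∃ e : Fin C.length ≃ Fin N.length, ∀ l, s(C.s l, C.t l) = s(N.s (e l), N.t (e l))

theorem EdgeEquiv.cycle_eq {C N : Circuit n} (h : C.EdgeEquiv N) : C.cycle = N.cycle := by
  obtain ⟨e, he⟩ := h
  simp only [cycle, he]
  exact e.surjective.range_comp fun l => s(N.s l, N.t l)

theorem EdgeEquiv.refl (C : Circuit n) : C.EdgeEquiv C := ⟨Equiv.refl _, fun _ => rfl⟩

theorem s_ne_t (C : Circuit n) (l : Fin C.length) : C.s l ≠ C.t l := fun h => by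
  have h1 := congrArg Fin.val (C.vertex_injective h)
  rw [finRotate_val] at h1
  have := C.two_lt_length
  split_ifs at h1 <;> omega

theorem ext_vertex {N N' : Circuit n} (h : N.length = N'.length)
    (hv : ∀ b : Fin N.length, N.vertex b = N'.vertex (Fin.cast h b)) : N = N' := by
  obtain ⟨k, hk, v, hi⟩ := N
  obtain ⟨k', hk', v', hi'⟩ := N'
  obtain rfl : k = k' := h
  obtain rfl : v = v' := funext hv
  rfl

/-- A standard circuit is brought to normal form by a rotation, after a reversal if the greatest
vertex precedes the second greatest one. -/
theorem IsStandard.exists_isNormal {C : Circuit n} (hC : C.IsStandard) :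
    ∃ N : Circuit n, N.IsNormal ∧ C.EdgeEquiv N := by
  obtain ⟨i, hi⟩ := hC
  have hk := C.two_lt_length
  have : NeZero C.length := ⟨by omega⟩
  have ht (l : Fin C.length) : C.t l = C.vertex (l + 1) := by rw [t, finRotate_apply]
  have h0 (h : 0 < C.length) : (⟨0, h⟩ : Fin C.length) = 0 := rfl
  have h1 (h : 1 < C.length) : (⟨1, h⟩ : Fin C.length) = 1 :=
    Fin.ext (by rw [Fin.val_one', Nat.mod_eq_of_lt h])
  have hne (j : Fin C.length) (hj : 2 ≤ (j : ℕ)) : j ≠ 0 ∧ j ≠ 1 := by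
    constructor
    · rintro rfl; simp at hj
    · rw [← h1 (by omega)]; intro h; simp [h] at hj
  rcases lt_or_gt_of_ne (C.s_ne_t i) with h | h
  · -- the greatest vertex follows the second greatest one: rotate
    let N : Circuit n := ⟨C.length, hk, fun j => C.vertex (i + j),
      C.vertex_injective.comp (add_right_injective i)⟩
    refine ⟨N, ⟨?_, fun j hj => ?_⟩, Equiv.subRight i, fun l => ?_⟩
    · simpa only [base, next, N, h0, h1, add_zero, ← ht, s] using h
    · have hb : N.base = C.s i := by simp only [base, N, h0, add_zero, s]
      rw [hb]
      refine (hi (i + j) (fun h => ?_) fun h => ?_).1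
      · exact (hne j hj).1 (by simpa using C.vertex_injective h)
      · rw [ht] at h
        exact (hne j hj).2 (by simpa using C.vertex_injective h)
    · simp only [s, t, finRotate_apply, N, Equiv.subRight_apply, add_sub_cancel, ← add_assoc]
  · -- the second greatest vertex follows the greatest one: reverse the orientation
    let N : Circuit n := ⟨C.length, hk, fun j => C.vertex (i + 1 - j),
      C.vertex_injective.comp (sub_right_injective (b := i + 1))⟩
    refine ⟨N, ⟨?_, fun j hj => ?_⟩, Equiv.subLeft i, fun l => ?_⟩
    · simpa only [base, next, N, h0, h1, sub_zero, add_sub_cancel_right, ← ht, s] using h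
    · have hb : N.base = C.t i := by simp only [base, N, h0, sub_zero, ht]
      rw [hb]
      refine (hi (i + 1 - j) (fun h => ?_) fun h => ?_).2
      · have := C.vertex_injective h
        rw [sub_eq_iff_eq_add, add_right_inj] at this
        exact (hne j hj).2 this.symm
      · rw [ht] at h
        exact (hne j hj).1 (by simpa using C.vertex_injective h)
    · rw [Sym2.eq_swap]
      simp only [s, t, finRotate_apply, N, Equiv.subLeft_apply]
      congr 3 <;> abel

/-! ### Ranks of vertices and the associated linear form on `E₂` -/

/-- The position of a vertex in a circuit, and `0` outside the circuit. -/
noncomputable def rank (N : Circuit n) : Fin n → ℕ :=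
  Function.extend N.vertex (fun j => (j : ℕ)) 0

theorem rank_vertex (N : Circuit n) (j : Fin N.length) : N.rank (N.vertex j) = j :=
  N.vertex_injective.extend_apply _ _ _

theorem rank_base (N : Circuit n) : N.rank N.base = 0 := N.rank_vertex _

theorem exists_vertex_of_rank_pos (N : Circuit n) {a : Fin n} (h : 0 < N.rank a) :
    ∃ j, N.vertex j = a := by
  by_contra hj
  rw [rank, Function.extend_apply' _ _ _ hj] at h
  exact h.ne' rfl

/-- The images of the generators of `E₂` in `ℕ → ℚ`, with standard vectors `e 0, e 1, …`: the
class `x` of the base point of `N` goes to `e 1`, and `ω i j` goes to `e r`, where `r`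
is the greater of the ranks of `i` and `j`, if both ranks are positive. All other generators go to `0`. -/
noncomputable def label (N : Circuit n) : Gen n → ℕ → ℚ
  | .x i => if i = N.base then Pi.single 1 1 else 0
  | .y _ => 0
  | .om i j => if i ≠ j ∧ 0 < N.rank i ∧ 0 < N.rank j then
      Pi.single (max (N.rank i) (N.rank j)) 1 else 0

theorem label_om_symm (N : Circuit n) (i j : Fin n) : N.label (.om i j) = N.label (.om j i) := by
  simp only [label, max_comm, ne_comm, and_comm]

theorem label_om_congr (N : Circuit n) {i j i' j' : Fin n} (h : s(i, j) = s(i', j')) :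
    N.label (.om i j) = N.label (.om i' j') := by
  rcases Sym2.eq_iff.1 h with ⟨rfl, rfl⟩ | ⟨rfl, rfl⟩
  · rfl
  · exact N.label_om_symm _ _

theorem ι_anticomm {M : Type*} [AddCommGroup M] [Module ℚ M] (u v : M) :
    ExteriorAlgebra.ι ℚ u * ExteriorAlgebra.ι ℚ v
      = -(ExteriorAlgebra.ι ℚ v * ExteriorAlgebra.ι ℚ u) :=
  eq_neg_of_add_eq_zero_left (ExteriorAlgebra.ι_add_mul_swap u v)

/-- The algebra homomorphism from `E₂` to an exterior algebra defined by `label`. The Arnold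
relation holds because in a triangle two of the three edges share the vertex of greatest rank, so
that their classes have the same image. -/
noncomputable def toExterior (N : Circuit n) : Alg n →ₐ[ℚ] ExteriorAlgebra ℚ (ℕ → ℚ) :=
  lift (FreeAlgebra.lift ℚ fun g => ExteriorAlgebra.ι ℚ (N.label g)) fun a b h => by
    cases h with
    | anticomm g h => simpa using ι_anticomm _ _
    | symm i j => simp [N.label_om_symm i j]
    | diag i => simp [label]
    | x_om i j =>
      have h (a b : Fin n) (hb : a ≠ b) : (N.label (.x a) = 0 ∧ N.label (.x b) = 0) ∨
          N.label (.om a b) = 0 := by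
        by_cases hi : a = N.base
        · simp [label, hi, rank_base]
        by_cases hj : b = N.base
        · simp [label, hj, rank_base]
        simp [label, hi, hj]
      rcases eq_or_ne i j with rfl | hij
      · rfl
      · rcases h i j hij with ⟨h1, h2⟩ | h <;> simp [*]
    | y_om i j => simp [label]
    | arnold i j k hij hjk hki =>
      simp only [map_add, map_mul, map_zero, FreeAlgebra.lift_ι_apply]
      by_cases hi : N.rank i = 0
      · simp [label, hi]
      by_cases hj : N.rank j = 0
      · simp [label, hj]
      by_cases hk : N.rank k = 0
      · simp [label, hk]
      have key (a b c : Fin n) (h1 : N.rank a ≤ N.rank c) (h2 : N.rank b ≤ N.rank c)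
          (ha : N.rank a ≠ 0) (hb : N.rank b ≠ 0) (hac : c ≠ a) (hbc : b ≠ c) :
          N.label (.om b c) = N.label (.om c a) := by
        have hc : 0 < N.rank c := by omega
        simp [label, h1, h2, hac, hbc, hc, Nat.pos_of_ne_zero ha, Nat.pos_of_ne_zero hb]
      rcases le_total (N.rank i) (N.rank j) with h1 | h1
      · rcases le_total (N.rank j) (N.rank k) with h2 | h2
        · rw [key i j k (h1.trans h2) h2 hi hj hki hjk, ι_anticomm (N.label (.om i j))]
          simp
        · rw [key k i j h2 h1 hk hi hjk hij, ι_anticomm (N.label (.om k i))]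
          simp
      · rcases le_total (N.rank i) (N.rank k) with h2 | h2
        · rw [key i j k h2 (h1.trans h2) hi hj hki hjk, ι_anticomm (N.label (.om i j))]
          simp
        · rw [key j k i h1 h2 hj hk hij hki, ι_anticomm (N.label (.om j k))]
          simp

theorem toExterior_gen (N : Circuit n) (g : Gen n) :
    N.toExterior (gen g) = ExteriorAlgebra.ι ℚ (N.label g) := by
  simp [toExterior, gen, lift_mk]

end Circuit

/-- The linear form on the exterior algebra of the space with coordinates `0, 1, …` which is the
coefficient of `e 1 * ⋯ * e (k - 1)`. -/
noncomputable def topForm (k : ℕ) : ExteriorAlgebra ℚ (ℕ → ℚ) →ₗ[ℚ] ℚ :=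
  ExteriorAlgebra.liftAlternating fun d =>
    if d + 1 = k then Matrix.detRowAlternating.compLinearMap
      (LinearMap.funLeft ℚ ℚ fun b : Fin d => (b : ℕ) + 1) else 0

theorem prod_map_ι {α M : Type*} [AddCommGroup M] [Module ℚ M] (f : α → M) (l : List α) :
    (l.map fun a => ExteriorAlgebra.ι ℚ (f a)).prod
      = ExteriorAlgebra.ιMulti ℚ l.length fun a => f (l.get a) := by
  rw [ExteriorAlgebra.ιMulti_apply]
  congr 1
  conv_lhs => rw [← List.ofFn_get l, List.map_ofFn]
  rfl

theorem topForm_prod {α : Type*} (k : ℕ) (f : α → ℕ → ℚ) (l : List α) :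
    topForm k (l.map fun a => ExteriorAlgebra.ι ℚ (f a)).prod
      = if l.length + 1 = k then
          (Matrix.of fun a b : Fin l.length => f (l.get a) ((b : ℕ) + 1)).det else 0 := by
  rw [prod_map_ι, topForm, ExteriorAlgebra.liftAlternating_apply_ιMulti]
  split_ifs <;> rfl

theorem topForm_prod_ne_zero_imp {α : Type*} {k : ℕ} {f : α → ℕ → ℚ} {l : List α}
    (h : topForm k (l.map fun a => ExteriorAlgebra.ι ℚ (f a)).prod ≠ 0) :
    l.length + 1 = k ∧ (l.map f).Nodup ∧ ∀ a ∈ l, f a ≠ 0 := by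
  rw [topForm_prod] at h
  split_ifs at h with hk
  · refine ⟨hk, ?_, fun a ha h0 => ?_⟩
    · rw [← List.ofFn_get l, List.map_ofFn, List.nodup_ofFn]
      intro a b hab
      by_contra hne
      exact h (Matrix.det_zero_of_row_eq hne (funext fun c => congrFun hab _))
    · obtain ⟨a, rfl⟩ := List.get_of_mem ha
      exact h (Matrix.det_eq_zero_of_row_eq_zero a fun b => by rw [Matrix.of_apply, h0]; rfl)
  · exact absurd rfl h

theorem topForm_prod_single_ne_zero {k : ℕ} {l : List ℕ} (hlen : l.length + 1 = k) (hl : l.Nodup)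
    (hmem : ∀ a ∈ l, 1 ≤ a ∧ a < k) :
    topForm k (l.map fun a => ExteriorAlgebra.ι ℚ (Pi.single a 1 : ℕ → ℚ)).prod ≠ 0 := by
  rw [topForm_prod, if_pos hlen]
  have hm (a : Fin l.length) : 1 ≤ l.get a ∧ l.get a < k := hmem _ (l.get_mem a)
  let σ : Fin l.length → Fin l.length := fun a => ⟨l.get a - 1, by have := hm a; omega⟩
  have hσ : Function.Injective σ := fun a b hab => by
    have h1 : l.get a - 1 = l.get b - 1 := congrArg Fin.val hab
    have := hm a
    have := hm b
    exact List.nodup_iff_injective_get.1 hl (by omega)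
  let e := Equiv.ofBijective σ (Finite.injective_iff_bijective.1 hσ)
  -- the rows form a permutation of the standard basis
  have hM : (Matrix.of fun a b : Fin l.length => (Pi.single (l.get a) 1 : ℕ → ℚ) ((b : ℕ) + 1))
      = (1 : Matrix (Fin l.length) (Fin l.length) ℚ).submatrix e id := by
    ext a b
    have h1 : (e a : ℕ) = l.get a - 1 := rfl
    have := hm a
    rw [Matrix.of_apply, Matrix.submatrix_apply, Matrix.one_apply, Pi.single_apply]
    simp only [id, Fin.ext_iff]
    congr 1
    rw [h1, eq_iff_iff]
    omega
  rw [hM, Matrix.det_permute, Matrix.det_one, mul_one]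
  simp

namespace Circuit

/-- The linear form on `E₂` attached to a circuit in normal form. -/
noncomputable def form (N : Circuit n) : Alg n →ₗ[ℚ] ℚ :=
  topForm N.length ∘ₗ N.toExterior.toLinearMap

theorem form_prod (N : Circuit n) (l : List (Gen n)) :
    N.form (l.map gen).prod
      = topForm N.length (l.map fun g => ExteriorAlgebra.ι ℚ (N.label g)).prod := by
  simp only [form, LinearMap.comp_apply, AlgHom.toLinearMap_apply, map_list_prod, List.map_map,
    Function.comp_def, toExterior_gen]

theorem form_sub_x_mul (N : Circuit n) (a b : Fin n) (w : Alg n) :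
    N.form ((x a - x b) * w)
      = ((if a = N.base then 1 else 0) - if b = N.base then 1 else 0) * N.form (x N.base * w) := by
  have h (a : Fin n) : N.toExterior (x a)
      = (if a = N.base then 1 else 0 : ℚ) • N.toExterior (x N.base) := by
    simp only [x, toExterior_gen, label]
    split_ifs <;> simp
  simp only [form, LinearMap.comp_apply, AlgHom.toLinearMap_apply, map_mul, map_sub]
  rw [h a, h b, ← sub_smul, smul_mul_assoc, map_smul, smul_eq_mul]

theorem form_L' (N C : Circuit n) : N.form C.L' = 0 := by
  have h (a b : Fin n) (w : Alg n) : N.form ((y a - y b) * w) = 0 := by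
    simp [form, y, toExterior_gen, label]
  simp only [L', map_sum, map_smul, h, smul_zero, Finset.sum_const_zero]

/-- The word in the generators whose product is `x` of the base point of `N` times
`C.omErase i j`. -/
def word (N C : Circuit n) (i j : Fin C.length) : List (Gen n) :=
  .x N.base :: (((List.finRange C.length).filter fun l => l ≠ i ∧ l ≠ j).map fun l =>
    .om (C.s l) (C.t l))

theorem prod_word (N C : Circuit n) (i j : Fin C.length) :
    ((N.word C i j).map gen).prod = x N.base * C.omErase i j := by
  rw [word, List.map_cons, List.prod_cons, List.map_map]; rfl

theorem form_L (N C : Circuit n) :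
    N.form C.L = ∑ i : Fin C.length, ∑ j ∈ Finset.Ioi i, (-1 : ℚ) ^ ((i : ℕ) + (j : ℕ)) •
      (((if C.t i = N.base then 1 else 0) - if C.s i = N.base then 1 else 0)
        * N.form ((N.word C i j).map gen).prod) := by
  simp only [L, map_sum, map_smul, form_sub_x_mul, prod_word]

theorem label_om_ne_zero {N : Circuit n} {i j : Fin n} (h : N.label (.om i j) ≠ 0) :
    0 < N.rank i ∧ 0 < N.rank j ∧
      N.label (.om i j) = Pi.single (max (N.rank i) (N.rank j)) 1 := by
  simp only [label] at h ⊢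
  split_ifs at h ⊢ with hc
  · exact ⟨hc.2.1, hc.2.2, rfl⟩
  · exact absurd rfl h

/-- If the linear form of `N` does not vanish on a word, then the edges other than `i` and `j` avoid
the base point, stay inside `N` and have distinct labels. -/
theorem form_word_ne_zero_imp {N C : Circuit n} {i j : Fin C.length} (hij : i ≠ j)
    (h : N.form ((N.word C i j).map gen).prod ≠ 0) :
    C.length = N.length ∧
      (∀ l, l ≠ i → l ≠ j → 0 < N.rank (C.s l) ∧ 0 < N.rank (C.t l)) ∧
      ∀ l l', l ≠ i → l ≠ j → l' ≠ i → l' ≠ j → max (N.rank (C.s l)) (N.rank (C.t l))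
        = max (N.rank (C.s l')) (N.rank (C.t l')) → l = l' := by
  rw [form_prod] at h
  obtain ⟨h1, h2, h3⟩ := topForm_prod_ne_zero_imp h
  have hk := C.two_lt_length
  have h4 (l) (hi : l ≠ i) (hj : l ≠ j) := label_om_ne_zero <| h3 (.om (C.s l) (C.t l)) <| by
    simp only [word, List.mem_cons, List.mem_map]
    exact Or.inr ⟨l, by simp [hi, hj], rfl⟩
  refine ⟨?_, fun l hi hj => ⟨(h4 l hi hj).1, (h4 l hi hj).2.1⟩, fun l l' hi hj hi' hj' he => ?_⟩
  · rw [word, List.length_cons, List.length_map, length_filter_finRange i j hij] at h1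
    omega
  · rw [word, List.map_cons, List.map_map] at h2
    have := List.inj_on_of_nodup_map (List.nodup_cons.1 h2).2
    refine this (by simp [hi, hj]) (by simp [hi', hj']) ?_
    simp only [Function.comp]
    rw [(h4 l hi hj).2.2, (h4 l' hi' hj').2.2, he]

theorem form_word_ne_zero {N C : Circuit n} (e : Fin C.length ≃ Fin N.length)
    (he : ∀ l, s(C.s l, C.t l) = s(N.s (e l), N.t (e l))) {i j : Fin C.length} (hij : i ≠ j)
    (h : ∀ l, l ≠ i → l ≠ j → 0 < (e l : ℕ) ∧ (e l : ℕ) + 1 < N.length) :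
    N.form ((N.word C i j).map gen).prod ≠ 0 := by
  have hk := C.two_lt_length
  have hkN : C.length = N.length := by simpa using Fintype.card_congr e
  have hl (l : Fin C.length) (hi : l ≠ i) (hj : l ≠ j) :
      N.label (.om (C.s l) (C.t l)) = Pi.single ((e l : ℕ) + 1) 1 := by
    obtain ⟨h1, h2⟩ := h l hi hj
    have hne := N.s_ne_t (e l)
    rw [N.label_om_congr (he l)]
    rw [N.t_of_lt _ h2, s] at hne ⊢
    simp only [label, rank_vertex]
    rw [if_pos ⟨hne, h1, by omega⟩, max_eq_right (by omega)]
  have hw : ((N.word C i j).map fun g => ExteriorAlgebra.ι ℚ (N.label g))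
      = (1 :: ((List.finRange C.length).filter fun l => l ≠ i ∧ l ≠ j).map
          fun l => (e l : ℕ) + 1).map fun a => ExteriorAlgebra.ι ℚ (Pi.single a 1 : ℕ → ℚ) := by
    simp only [word, List.map_cons, List.map_map, label, if_true, List.cons.injEq, true_and]
    refine List.map_congr_left fun l hl' => ?_
    simp only [List.mem_filter, decide_eq_true_eq] at hl'
    exact congrArg _ (hl l hl'.2.1 hl'.2.2)
  rw [form_prod, hw]
  refine topForm_prod_single_ne_zero ?_ ?_ ?_
  · rw [List.length_cons, List.length_map, length_filter_finRange i j hij]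
    omega
  · refine List.nodup_cons.2 ⟨?_, List.Nodup.map ?_ ((List.nodup_finRange _).filter _)⟩
    · simp only [List.mem_map, List.mem_filter, decide_eq_true_eq, not_exists, not_and]
      intro l hl' h1
      have := h l hl'.2.1 hl'.2.2
      omega
    · intro a b hab
      exact e.injective (Fin.ext (by simpa using hab))
  · simp only [List.mem_cons, List.mem_map, List.mem_filter, decide_eq_true_eq]
    rintro a (rfl | ⟨l, hl', rfl⟩)
    · omega
    · have := h l hl'.2.1 hl'.2.2
      omega

end Circuit

/-! ### The linear forms separate the circuits -/

namespace Circuit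

/-- Exactly one term of `L_C` survives, namely the one in which the two edges at the base point are
erased. -/
theorem form_L_ne_zero {N C : Circuit n} (h : C.EdgeEquiv N) : N.form C.L ≠ 0 := by
  obtain ⟨e, he⟩ := h
  have hk := N.two_lt_length
  let z : Fin N.length := ⟨0, by omega⟩
  let w : Fin N.length := ⟨N.length - 1, by omega⟩
  -- the two edges at the base point of `N`
  have hbase (l : Fin C.length) :
      (C.s l = N.base ∨ C.t l = N.base) ↔ l = e.symm z ∨ l = e.symm w := by
    have h1 : (C.s l = N.base ∨ C.t l = N.base) ↔ N.base ∈ s(C.s l, C.t l) := by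
      rw [Sym2.mem_iff, @eq_comm _ N.base (C.s l), @eq_comm _ N.base (C.t l)]
    have h2 (m : Fin N.length) : N.base ∈ s(N.s m, N.t m) ↔ m = z ∨ m = w := by
      have hs : N.base = N.s m ↔ z = m := N.vertex_injective.eq_iff
      have ht : N.base = N.t m ↔ z = finRotate _ m := N.vertex_injective.eq_iff
      rw [Sym2.mem_iff, hs, ht, Fin.ext_iff, Fin.ext_iff, Fin.ext_iff, Fin.ext_iff, finRotate_val]
      simp only [z, w]
      split_ifs
      · omega
      · rw [or_iff_left not_false]
        omega
    rw [h1, he, h2, Equiv.eq_symm_apply, Equiv.eq_symm_apply]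
  obtain ⟨i, j, hij, hset⟩ : ∃ i j, i < j ∧ ∀ l, l = i ∨ l = j ↔ l = e.symm z ∨ l = e.symm w := by
    have hne : e.symm z ≠ e.symm w := fun h => by
      have := congrArg Fin.val (e.symm.injective h)
      simp only [z, w] at this
      omega
    rcases lt_or_gt_of_ne hne with h | h
    · exact ⟨_, _, h, fun _ => Iff.rfl⟩
    · exact ⟨_, _, h, fun _ => or_comm⟩
  -- all other terms of `L_C` contain the class of an edge at the base point
  have hzero (i' j' : Fin C.length) (hij' : i' < j') (hne : ¬(i' = i ∧ j' = j)) :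
      N.form ((N.word C i' j').map gen).prod = 0 := by
    by_contra h0
    obtain ⟨-, hpos, -⟩ := form_word_ne_zero_imp hij'.ne h0
    have hmem (l) (hl : l = i ∨ l = j) : l = i' ∨ l = j' := by
      by_contra! hl'
      have := hpos l hl'.1 hl'.2
      rcases (hbase l).2 ((hset l).1 hl) with h | h <;> rw [h, rank_base] at this <;> omega
    rcases hmem i (Or.inl rfl) with rfl | rfl <;> rcases hmem j (Or.inr rfl) with rfl | rfl
    · exact hij.ne rfl
    · exact hne ⟨rfl, rfl⟩
    · exact hij.not_gt hij'
    · exact hij.ne rfl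
  rw [form_L, Finset.sum_eq_single i, Finset.sum_eq_single j]
  · refine smul_ne_zero (pow_ne_zero _ (by norm_num)) (mul_ne_zero ?_ ?_)
    · have hi := (hbase i).2 ((hset i).1 (Or.inl rfl))
      have hne := C.s_ne_t i
      rcases hi with hi | hi <;> rw [hi] at hne ⊢
      · simp [hne.symm]
      · simp [hne]
    · refine form_word_ne_zero e he hij.ne fun l hi hj => ?_
      have hl : ¬(l = e.symm z ∨ l = e.symm w) := by
        rw [← hset]; tauto
      rw [Equiv.eq_symm_apply, Equiv.eq_symm_apply] at hl
      simp only [Fin.ext_iff, z, w] at hl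
      omega
  · intro j' hj' hne
    rw [hzero i j' (Finset.mem_Ioi.1 hj') fun h => hne h.2, mul_zero, smul_zero]
  · exact fun h => absurd (Finset.mem_Ioi.2 hij) h
  · intro i' _ hne
    refine Finset.sum_eq_zero fun j' hj' => ?_
    rw [hzero i' j' (Finset.mem_Ioi.1 hj') fun h => hne h.1, mul_zero, smul_zero]
  · exact fun h => absurd (Finset.mem_univ _) h

/-- A sequence of distinct positive integers `ρ 1 = 1, ρ 2, …, ρ (k - 1)` less than `k`, in which the
maxima of consecutive terms are distinct, has no interior local maximum. Hence it is increasing and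
equal to `1, 2, …, k - 1`. -/
theorem eq_self_of_max_injective {k : ℕ} {ρ : ℕ → ℕ} (h1 : ρ 1 = 1)
    (hinj : ∀ b c, b < k → c < k → ρ b = ρ c → b = c) (hpos : ∀ b, 1 ≤ b → b < k → 0 < ρ b)
    (hlt : ∀ b, b < k → ρ b < k)
    (hmax : ∀ b c, 1 ≤ b → b + 1 < k → 1 ≤ c → c + 1 < k →
      max (ρ b) (ρ (b + 1)) = max (ρ c) (ρ (c + 1)) → b = c) :
    ∀ b, 1 ≤ b → b < k → ρ b = b := by
  have hmono (b : ℕ) (hb : 1 ≤ b) : b + 1 < k → ρ b < ρ (b + 1) := by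
    induction b, hb using Nat.le_induction with
    | base =>
      intro hk
      have := hpos 2 (by omega) (by omega)
      have := hinj 1 2 (by omega) (by omega)
      simp only [Nat.reduceAdd]
      omega
    | succ b hb ih =>
      intro hk
      have := ih (by omega)
      by_contra hle
      have := hmax b (b + 1) hb (by omega) (by omega) hk (by omega)
      omega
  have hge (b : ℕ) (hb : 1 ≤ b) : b < k → b ≤ ρ b := by
    induction b, hb using Nat.le_induction with
    | base => intro _; omega
    | succ b hb ih =>
      intro hk
      have := ih (by omega)
      have := hmono b hb hk
      omega
  have hle (m : ℕ) : ∀ b, 1 ≤ b → b + m + 1 = k → ρ b + m + 1 ≤ k := by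
    induction m with
    | zero => intro b hb hk; have := hlt b (by omega); omega
    | succ m ih =>
      intro b hb hk
      have := ih (b + 1) (by omega) (by omega)
      have := hmono b hb (by omega)
      omega
  intro b hb hk
  have := hge b hb hk
  have := hle (k - 1 - b) b hb (by omega)
  omega

theorem IsNormal.vertex_le_next {N : Circuit n} (hN : N.IsNormal) (j : Fin N.length) :
    N.vertex j ≤ N.next := by
  obtain ⟨j, hj⟩ := j
  match j with
  | 0 => exact hN.1.le
  | 1 => exact le_rfl
  | j + 2 => exact ((hN.2 ⟨j + 2, hj⟩ (by simp)).trans hN.1).le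

theorem IsNormal.vertex_le_base {N : Circuit n} (hN : N.IsNormal) (j : Fin N.length)
    (h : N.vertex j ≠ N.next) : N.vertex j ≤ N.base := by
  obtain ⟨j, hj⟩ := j
  match j with
  | 0 => exact le_rfl
  | 1 => exact absurd rfl h
  | j + 2 => exact (hN.2 ⟨j + 2, hj⟩ (by simp)).le

/-- The combinatorial conditions which the nonvanishing of the linear form of `N` on a term of `L_C`
imposes on the normal form `N'` of `C` force `N' = N`. -/
theorem IsNormal.eq_of_rank {N N' : Circuit n} (hN : N.IsNormal) (hN' : N'.IsNormal)
    (hlen : N'.length = N.length) (i j : Fin N'.length)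
    (hpos : ∀ b, b ≠ i → b ≠ j → 0 < N.rank (N'.s b) ∧ 0 < N.rank (N'.t b))
    (hmax : ∀ b c, b ≠ i → b ≠ j → c ≠ i → c ≠ j → max (N.rank (N'.s b)) (N.rank (N'.t b))
        = max (N.rank (N'.s c)) (N.rank (N'.t c)) → b = c)
    (hbase : ∃ a, N'.vertex a = N.base) : N' = N := by
  have hk := N.two_lt_length
  obtain ⟨a, ha⟩ := hbase
  -- the edges which meet the base point of `N` are `i` and `j`
  have hedge (b : Fin N'.length) (hb : b = a ∨ finRotate _ b = a) : b = i ∨ b = j := by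
    by_contra! hne
    have := hpos b hne.1 hne.2
    rcases hb with rfl | hb
    · rw [s, ha, rank_base] at this; omega
    · rw [t, hb, ha, rank_base] at this; omega
  have hij : ∀ b, b = i ∨ b = j → b = a ∨ finRotate _ b = a := by
    obtain ⟨c, hc⟩ := (finRotate N'.length).surjective a
    have hca : c ≠ a := by
      rintro rfl
      exact N'.s_ne_t c (congrArg N'.vertex hc.symm)
    have h1 := hedge a (Or.inl rfl)
    have h2 := hedge c (Or.inr hc)
    rintro b hb
    by_cases hba : b = a
    · exact Or.inl hba
    · have : b = c := by
        rcases h1 with rfl | rfl <;> rcases h2 with rfl | rfl <;> tauto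
      rw [this]
      exact Or.inr hc
  have hrank (b : Fin N'.length) (hb : b ≠ a) : 0 < N.rank (N'.vertex b) := by
    by_cases h : b = i ∨ b = j
    · have hba := (hij b h).resolve_left hb
      obtain ⟨c, rfl⟩ := (finRotate N'.length).surjective b
      have hc : ¬(c = i ∨ c = j) := fun hc => by
        rcases hij c hc with rfl | h
        · have := congrArg Fin.val hba
          rw [finRotate_val, finRotate_val] at this
          split_ifs at this <;> omega
        · exact hb h
      push Not at hc
      exact (hpos c hc.1 hc.2).2
    · push Not at h
      exact (hpos b h.1 h.2).1
  have hex (b : Fin N'.length) : ∃ c, N.vertex c = N'.vertex b := by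
    by_cases h : b = a
    · exact ⟨_, (h ▸ ha).symm⟩
    · exact N.exists_vertex_of_rank_pos (hrank b h)
  choose f hf using hex
  have hfinj : Function.Injective f := fun b c h =>
    N'.vertex_injective (by rw [← hf, ← hf, h])
  have hfsurj : Function.Surjective f :=
    ((Fintype.bijective_iff_injective_and_card f).2 ⟨hfinj, by simp [hlen]⟩).2
  have hrf (b : Fin N'.length) : N.rank (N'.vertex b) = f b := by rw [← hf, rank_vertex]
  -- the two greatest vertices agree
  have hnext : N'.next = N.next := by
    refine le_antisymm ?_ ?_
    · rw [next, ← hf]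
      exact hN.vertex_le_next _
    · obtain ⟨b, hb⟩ := hfsurj ⟨1, by omega⟩
      rw [next, ← hb, hf]
      exact hN'.vertex_le_next _
  have hbase : N'.base = N.base := by
    refine le_antisymm ?_ ?_
    · have h := hN'.1.ne
      rw [hnext, base, ← hf] at h
      rw [base, ← hf]
      exact hN.vertex_le_base _ h
    · rw [← ha]
      refine hN'.vertex_le_base _ ?_
      rw [ha, hnext]
      exact hN.1.ne
  have ha0 : (a : ℕ) = 0 := by
    rw [← ha] at hbase
    exact (congrArg Fin.val (N'.vertex_injective hbase)).symm
  have hout (b : Fin N'.length) (h1 : 1 ≤ (b : ℕ)) (h2 : (b : ℕ) + 1 < N'.length) :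
      b ≠ i ∧ b ≠ j := by
    by_contra h
    rcases hij b (by tauto) with h | h
    · rw [h] at h1; omega
    · have := congrArg Fin.val h
      rw [finRotate_val, if_neg (by omega)] at this
      omega
  let ρ : ℕ → ℕ := fun b => if h : b < N'.length then N.rank (N'.vertex ⟨b, h⟩) else 0
  have hρ (b : ℕ) (h : b < N'.length) : ρ b = N.rank (N'.vertex ⟨b, h⟩) := dif_pos h
  have hself := eq_self_of_max_injective (k := N'.length) (ρ := ρ)
    (by rw [hρ 1 (by omega)]; change N.rank N'.next = 1; rw [hnext]; exact N.rank_vertex _)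
    (fun b c hb hc h => by
      rw [hρ b hb, hρ c hc, hrf, hrf] at h
      exact congrArg Fin.val (hfinj (Fin.ext h)))
    (fun b h1 hb => by
      rw [hρ b hb]
      exact hrank _ fun h => by have := congrArg Fin.val h; simp only at this; omega)
    (fun b hb => by rw [hρ b hb, hrf]; omega)
    (fun b c hb1 hb hc1 hc h => by
      rw [hρ b (by omega), hρ c (by omega), hρ _ hb, hρ _ hc] at h
      obtain ⟨hbi, hbj⟩ := hout ⟨b, by omega⟩ hb1 hb
      obtain ⟨hci, hcj⟩ := hout ⟨c, by omega⟩ hc1 hc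
      refine congrArg Fin.val (hmax _ _ hbi hbj hci hcj ?_)
      rw [N'.t_of_lt _ hb, N'.t_of_lt _ hc]
      exact h)
  refine ext_vertex hlen fun b => ?_
  rw [← hf]
  refine congrArg N.vertex (Fin.ext ?_)
  rw [← hrf]
  change _ = (b : ℕ)
  rcases Nat.eq_zero_or_pos (b : ℕ) with h | h
  · have : b = a := Fin.ext (by omega)
    rw [this, ha, rank_base, ha0]
  · have := hself b h b.2
    rwa [hρ b b.2] at this

theorem IsNormal.eq_of_form_ne_zero {N N' C : Circuit n} (hN : N.IsNormal) (hN' : N'.IsNormal)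
    (hC : C.EdgeEquiv N') (h : N.form C.L ≠ 0) : N' = N := by
  obtain ⟨e, he⟩ := hC
  rw [form_L] at h
  obtain ⟨i, -, h⟩ := Finset.exists_ne_zero_of_sum_ne_zero h
  obtain ⟨j, hij, h⟩ := Finset.exists_ne_zero_of_sum_ne_zero h
  obtain ⟨-, h⟩ := smul_ne_zero_iff.1 h
  obtain ⟨hx, h⟩ := mul_ne_zero_iff.1 h
  obtain ⟨hlen, hpos, hmax⟩ := form_word_ne_zero_imp (Finset.mem_Ioi.1 hij).ne h
  have hlen' : C.length = N'.length := by simpa using Fintype.card_congr e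
  have hst (b : Fin N'.length) : (C.s (e.symm b) = N'.s b ∧ C.t (e.symm b) = N'.t b) ∨
      (C.s (e.symm b) = N'.t b ∧ C.t (e.symm b) = N'.s b) := by
    have := he (e.symm b)
    rw [Equiv.apply_symm_apply] at this
    exact Sym2.eq_iff.1 this
  have hmaxeq (b : Fin N'.length) : max (N.rank (N'.s b)) (N.rank (N'.t b))
      = max (N.rank (C.s (e.symm b))) (N.rank (C.t (e.symm b))) := by
    rcases hst b with ⟨h1, h2⟩ | ⟨h1, h2⟩ <;> rw [h1, h2]
    exact max_comm _ _
  have hne (b : Fin N'.length) (i : Fin C.length) (h : b ≠ e i) : e.symm b ≠ i :=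
    fun h' => h (by rw [← h', Equiv.apply_symm_apply])
  refine hN.eq_of_rank hN' (hlen'.symm.trans hlen) (e i) (e j) (fun b hi hj => ?_)
    (fun b c hbi hbj hci hcj h => ?_) ?_
  · have := hpos (e.symm b) (hne b i hi) (hne b j hj)
    rcases hst b with ⟨h1, h2⟩ | ⟨h1, h2⟩
    · rwa [h1, h2] at this
    · rw [h1, h2] at this
      exact this.symm
  · rw [hmaxeq, hmaxeq] at h
    exact e.symm.injective (hmax _ _ (hne b i hbi) (hne b j hbj) (hne c i hci) (hne c j hcj) h)
  · have hb : C.s i = N.base ∨ C.t i = N.base := by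
      by_contra! hb
      exact hx (by simp [hb.1, hb.2])
    have := hst (e i)
    rw [Equiv.symm_apply_apply] at this
    rcases this with ⟨h1, h2⟩ | ⟨h1, h2⟩ <;> rw [h1, h2] at hb <;> rcases hb with hb | hb <;>
      exact ⟨_, hb⟩

end Circuit

theorem linearIndependent_of_dual_ne_zero {ι M : Type*} [AddCommGroup M] [Module ℚ M] (v : ι → M)
    (f : ι → M →ₗ[ℚ] ℚ) (h : ∀ i, f i (v i) ≠ 0) (h0 : ∀ i j, f i (v j) ≠ 0 → i = j) :
    LinearIndependent ℚ v := by
  refine LinearIndependent.of_pairwise_dual_eq_zero_one v (fun i => (f i (v i))⁻¹ • f i)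
    (fun i j hij => ?_) fun i => ?_
  · change ((f i (v i))⁻¹ • f i) (v j) = 0
    rw [LinearMap.smul_apply, not_not.1 (mt (h0 i j) hij), smul_zero]
  · exact inv_mul_cancel₀ (h i)

/-- The elements `L_C` and `L'_C` are independent as soon as the circuits have different normal
forms. -/
theorem linearIndependent_L_L' {ι : Type*} (C N : ι → Circuit n) (hN : ∀ i, (N i).IsNormal)
    (hC : ∀ i, (C i).EdgeEquiv (N i)) (hinj : Function.Injective N) :
    LinearIndependent ℚ (Sum.elim (fun i => (C i).L) fun i => (C i).L') := by
  refine linearIndependent_of_dual_ne_zero _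
    (Sum.elim (fun i => (N i).form) fun i => (N i).form ∘ₗ (rot n).toLinearMap) ?_ ?_
  · rintro (i | i)
    · exact Circuit.form_L_ne_zero (hC i)
    · simpa [Circuit.rot_L'] using Circuit.form_L_ne_zero (hC i)
  · have key (i j : ι) (h : (N i).form (C j).L ≠ 0) : i = j :=
      hinj ((hN i).eq_of_form_ne_zero (hN j) (hC j) h).symm
    rintro (i | i) (j | j) h
    · exact congrArg _ (key i j h)
    · exact absurd (Circuit.form_L' _ _) h
    · refine absurd ?_ h
      simp [Circuit.rot_L, Circuit.form_L']
    · refine congrArg _ (key i j ?_)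
      simpa [Circuit.rot_L'] using h

/-! ### The lower bound for the dimension -/

/-- The circuit in normal form with set of vertices `V` in which the vertices after the two greatest
ones are arranged by the permutation `σ`. -/
def normalCircuit {q : ℕ} (hq : 1 ≤ q) (V : Finset (Fin n)) (hV : V.card = q + 2)
    (σ : Equiv.Perm (Fin q)) : Circuit n where
  length := q + 2
  two_lt_length := by omega
  vertex := fun j => V.orderEmbOfFin hV
    (if h : 2 ≤ (j : ℕ) then ⟨σ ⟨j - 2, by omega⟩, by omega⟩ else ⟨q + j, by omega⟩)
  vertex_injective := (V.orderEmbOfFin hV).injective.comp fun a b h => by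
    split_ifs at h with h1 h2 h2 <;> simp only [Fin.mk.injEq] at h
    · have := congrArg Fin.val (σ.injective (Fin.ext h))
      simp only at this
      omega
    · omega
    · omega
    · omega

theorem isNormal_normalCircuit {q : ℕ} (hq : 1 ≤ q) (V : Finset (Fin n)) (hV : V.card = q + 2)
    (σ : Equiv.Perm (Fin q)) : (normalCircuit hq V hV σ).IsNormal := by
  refine ⟨(V.orderEmbOfFin hV).strictMono ?_, fun j hj => (V.orderEmbOfFin hV).strictMono ?_⟩
  · simp
  · simp [hj, Fin.lt_def]

theorem normalCircuit_injective {q : ℕ} (hq : 1 ≤ q) {V V' : Finset (Fin n)} (hV : V.card = q + 2)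
    (hV' : V'.card = q + 2) {σ σ' : Equiv.Perm (Fin q)}
    (h : normalCircuit hq V hV σ = normalCircuit hq V' hV' σ') : V = V' ∧ σ = σ' := by
  have himage (V : Finset (Fin n)) (hV : V.card = q + 2) (σ : Equiv.Perm (Fin q)) :
      Finset.univ.image (normalCircuit hq V hV σ).vertex = V := by
    refine Finset.eq_of_subset_of_card_le (fun a ha => ?_) ?_
    · obtain ⟨j, -, rfl⟩ := Finset.mem_image.1 ha
      exact V.orderEmbOfFin_mem hV _
    · rw [Finset.card_image_of_injective _ (normalCircuit hq V hV σ).vertex_injective,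
        Finset.card_univ, Fintype.card_fin, hV]
      rfl
  have hVV : V = V' := by
    rw [← himage V hV σ, ← himage V' hV' σ', h]
  subst hVV
  refine ⟨rfl, Equiv.ext fun j => ?_⟩
  have h1 := Circuit.mk.inj h
  have h2 := congrFun (eq_of_heq h1.2) ⟨j + 2, by omega⟩
  have h3 := (V.orderEmbOfFin hV).injective h2
  simpa [Fin.ext_iff] using h3

theorem finite_E₂ (n p q : ℕ) : Module.Finite ℚ (E₂ n p q) := by
  have hf : Finite (Gen n) := by
    refine Finite.of_surjective (fun a : Fin n ⊕ Fin n ⊕ (Fin n × Fin n) => match a with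
      | .inl i => Gen.x i
      | .inr (.inl i) => Gen.y i
      | .inr (.inr (i, j)) => Gen.om i j) fun g => ?_
    cases g with
    | x i => exact ⟨.inl i, rfl⟩
    | y i => exact ⟨.inr (.inl i), rfl⟩
    | om i j => exact ⟨.inr (.inr (i, j)), rfl⟩
  refine Module.Finite.span_of_finite ℚ (((List.finite_length_eq (Gen n) (p + q)).image
    fun l => (l.map gen).prod).subset ?_)
  rintro a ⟨l, hp, hq, rfl⟩
  refine ⟨l, ?_, rfl⟩
  rw [Set.mem_ofPred_eq, List.length_eq_countP_add_countP (fun g => g.isBase), hp]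
  congr 1
  rw [← hq]
  congr 1
  ext g
  simp

theorem e₃_one_ge (n q : ℕ) (hq : 1 ≤ q) : 2 * n.choose (q + 2) * q.factorial ≤ e₃ n 1 q := by
  let T := {V : Finset (Fin n) // V.card = q + 2} × Equiv.Perm (Fin q)
  let C : T → Circuit n := fun a => normalCircuit hq a.1 a.1.2 a.2
  have hC : Function.Injective C := fun a b h => by
    obtain ⟨h1, h2⟩ := normalCircuit_injective hq a.1.2 b.1.2 h
    exact Prod.ext (Subtype.ext h1) h2
  have hli := linearIndependent_L_L' C C (fun a => isNormal_normalCircuit hq _ _ _)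
    (fun a => Circuit.EdgeEquiv.refl _) hC
  have hmem (a : T ⊕ T) : Sum.elim (fun a => (C a).L) (fun a => (C a).L') a ∈ cycles n 1 q := by
    rcases a with a | a
    · exact ⟨(C a).L_mem, (C a).d_L⟩
    · exact ⟨(C a).L'_mem, (C a).d_L'⟩
  have := finite_E₂ n 1 q
  have hfin : Module.Finite ℚ (cycles n 1 q) :=
    Submodule.finiteDimensional_of_le (inf_le_left : cycles n 1 q ≤ E₂ n 1 q)
  have hli' : LinearIndependent ℚ fun a : T ⊕ T => (⟨_, hmem a⟩ : cycles n 1 q) :=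
    LinearIndependent.of_comp (cycles n 1 q).subtype hli
  have hb : (boundaries n 1 q).submoduleOf (cycles n 1 q) = ⊥ := by
    simp [boundaries, Submodule.submoduleOf]
  have hcard : Fintype.card (T ⊕ T) = 2 * n.choose (q + 2) * q.factorial := by
    have h1 : Fintype.card T = n.choose (q + 2) * q.factorial := by
      rw [Fintype.card_prod, Fintype.card_finset_len, Fintype.card_perm, Fintype.card_fin,
        Fintype.card_fin]
    rw [Fintype.card_sum, h1]
    ring
  rw [e₃, (Submodule.quotEquivOfEqBot _ hb).finrank_eq, ← hcard]
  exact hli'.fintype_card_le_finrank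

end BraidElliptic

theorem mainTheorem6 (n : ℕ) :
    (∀ S : Set (BraidElliptic.Circuit n),
      (∀ C ∈ S, C.IsStandard) → Set.InjOn BraidElliptic.Circuit.cycle S →
        (∀ C ∈ S, C.L ∈ BraidElliptic.E₂ n 1 (C.length - 2) ∧
          C.L' ∈ BraidElliptic.E₂ n 1 (C.length - 2)) ∧
        LinearIndependent ℚ
          (Sum.elim (fun C : S => (C : BraidElliptic.Circuit n).L)
            (fun C : S => (C : BraidElliptic.Circuit n).L'))) ∧
    ∀ q : ℕ, 1 ≤ q → 2 * n.choose (q + 2) * q.factorial ≤ BraidElliptic.e₃ n 1 q := by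
  refine ⟨fun S hS hinj => ⟨fun C _ => ⟨C.L_mem, C.L'_mem⟩, ?_⟩, BraidElliptic.e₃_one_ge n⟩
  choose N hN hC using fun C : S => (hS C C.2).exists_isNormal
  refine BraidElliptic.linearIndependent_L_L' (fun C : S => (C : BraidElliptic.Circuit n)) N hN hC
    fun C C' h => Subtype.ext (hinj C.2 C'.2 ?_)
  rw [(hC C).cycle_eq, (hC C').cycle_eq, h]
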